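/- Let $d\in\mathbb N$, let $(\Omega_n)_{n\in\mathbb N}$ be an increasing sequence of open subsets of $\mathbb R^d$ and let $\Omega=\bigcup_{n}\Omega_n$. Let $a\in L_\infty(\Omega;\mathbb C^{d\times d})$ be uniformly elliptic, i.e. there is $\eta>0$ such that $$\operatorname{Re}\sum_{i,j=1}^d a_{ij}(x)\,\xi_j\,\overline{\xi_i}\ \ge\ \eta\,|\xi|^2\qquad\text{for all }\xi\in\mathbb C^d\text{ and a.e. }x\in\Omega .$$ For every open $U\subseteq\mathbb R^d$ regard $L_2(U)$ as the subspace of $L_2(\mathbb R^d)$ of functions vanishing a.e. outside $U$, and regard $H^1_0(U)$, the closure of $C_c^\infty(U)$ in $H^1$, as a subspace of $H^1(\mathbb R^d)$ by extension by zero (all functions are complex valued). If $U\subseteq\Omega$ is open and $v_0\in L_2(U)$, a solution of the Dirichlet problem $$\partial_t v-\operatorname{div}(a\nabla v)=0\ \text{ in }(0,\infty)\times U,\qquad v=0\ \text{ on }(0,\infty)\times\partial U,\qquad v(0,\cdot)=v_0\ \text{ in }U,$$ is a function $v\in C([0,\infty);L_2(U))\cap L_{2,\mathrm{loc}}((0,\infty);H^1_0(U))$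 with $v(0)=v_0$ and $$\int_U v(t)\,\psi\,dx-\int_U v(s)\,\psi\,dx=-\int_s^t\int_U (a\nabla v(r))\cdot\nabla\psi\,dx\,dr\qquad\text{for all }0<s\le t,\ \psi\in C_c^\infty(U).$$ For every $n$ let $u_{0,n}\in L_2(\Omega_n)$ and let $u_n\in C([0,\infty);L_2(\Omega_n))$ be the solution of this problem on $U=\Omega_n$ with initial value $u_{0,n}$; let $u_0\in L_2(\Omega)$ and let $u\in C([0,\infty);L_2(\Omega))$ be the solution on $U=\Omega$ with initial value $u_0$. If $\lim_{n\to\infty}\|u_{0,n}-u_0\|_{L_2(\mathbb R^d)}=0$, then for every $T>0$ $$\lim_{n\to\infty}\ \sup_{t\in[0,T]}\|u_n(t)-u(t)\|_{L_2(\mathbb R^d)}=0 .$$ -/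

import Mathlib

open MeasureTheory Set Filter Topology TopologicalSpace
open scoped ENNReal Distributions

noncomputable section

namespace VaryingDomains

/-- The Euclidean space `ℝ^d`. -/
abbrev Space (d : ℕ) : Type := EuclideanSpace ℝ (Fin d)

/-- `L_2(ℝ^d)`, complex valued. -/
abbrev L2 (d : ℕ) : Type := Lp ℂ 2 (volume : Measure (Space d))

/-- `L_2(ℝ^d; ℂ^d)`. -/
abbrev L2Vec (d : ℕ) : Type := Lp (EuclideanSpace ℂ (Fin d)) 2 (volume : Measure (Space d))

/-- `L_2(Ω)` as a subspace of `L_2(ℝ^d)`: the functions that vanish almost everywhere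
outside `Ω`. -/
def L2On {d : ℕ} (Ω : Opens (Space d)) : Set (L2 d) :=
  {f | ∀ᵐ x ∂(volume : Measure (Space d)), x ∉ Ω → f x = 0}

/-- The classical gradient `(∂_1 φ, …, ∂_d φ)` of a complex valued function on `ℝ^d`. -/
def grad {d : ℕ} (φ : Space d → ℂ) (x : Space d) : EuclideanSpace ℂ (Fin d) :=
  WithLp.toLp 2 fun i => fderiv ℝ φ x (EuclideanSpace.single i 1)

/-- `f` belongs to `H^1(ℝ^d)` and `g` is its weak gradient. -/
def IsWeakGradient {d : ℕ} (f : L2 d) (g : L2Vec d) : Prop :=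
  ∀ (φ : 𝓓((⊤ : Opens (Space d)), ℂ)) (i : Fin d),
    ∫ x, f x * grad φ x i = -∫ x, g x i * φ x

/-- `f` belongs to `H^1_0(Ω)`, regarded as a subspace of `H^1(ℝ^d)`, and `g` is its weak gradient:
`f` lies in `H^1(ℝ^d)` and can be approximated in the norm of `H^1(ℝ^d)` by functions in
`C_c^∞(Ω)` (extended by zero). -/
structure IsH10WithGradient {d : ℕ} (Ω : Opens (Space d)) (f : L2 d) (g : L2Vec d) : Prop where
  isWeakGradient : IsWeakGradient f g
  approx : ∀ ε : ℝ≥0∞, 0 < ε → ∃ φ : 𝓓(Ω, ℂ),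
    eLpNorm (fun x => f x - φ x) 2 volume < ε ∧
    eLpNorm (fun x => g x - grad φ x) 2 volume < ε

/-- `∑_{i,j} a_{ij} ξ_j ζ_i` for `a ∈ ℂ^{d×d}` and `ξ, ζ ∈ ℂ^d` (bilinear, no conjugation). -/
def matPair {d : ℕ} (a : Matrix (Fin d) (Fin d) ℂ) (ξ ζ : EuclideanSpace ℂ (Fin d)) : ℂ :=
  ∑ i, ∑ j, a i j * ξ j * ζ i

/-- The coefficient matrix `a` is in `L_∞(Ω; ℂ^{d×d})`. -/
def IsBoundedCoeff {d : ℕ} (Ω : Opens (Space d)) (a : Space d → Matrix (Fin d) (Fin d) ℂ) : Prop :=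
  ∀ i j, MemLp (fun x => a x i j) ∞ (volume.restrict (Ω : Set (Space d)))

/-- Uniform ellipticity on `Ω`: for some `η > 0` and almost every `x ∈ Ω`,
`Re ∑_{i,j} a_{ij}(x) ξ_j conj(ξ_i) ≥ η |ξ|²` for all `ξ ∈ ℂ^d`. -/
def IsUniformlyElliptic {d : ℕ} (Ω : Opens (Space d))
    (a : Space d → Matrix (Fin d) (Fin d) ℂ) : Prop :=
  ∃ η : ℝ, 0 < η ∧ ∀ᵐ x ∂(volume.restrict (Ω : Set (Space d))), ∀ ξ : EuclideanSpace ℂ (Fin d),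
    η * ‖ξ‖ ^ 2 ≤ (∑ i, ∑ j, a x i j * ξ j * (starRingEnd ℂ) (ξ i)).re

/-- `u ∈ C([0,∞); L_2(Ω))` is the weak solution of
`∂_t u - div (a ∇u) = 0` in `(0,∞) × Ω`, `u = 0` on `(0,∞) × ∂Ω`, `u(0) = u₀` in `Ω`.

The values `u t` for `t < 0` play no role. The boundary condition is `u(t) ∈ H^1_0(Ω)` for almost
every `t > 0`, with `u ∈ L_2((δ,T); H^1_0(Ω))` whenever `0 < δ < T`; `g t` is the gradient of `u t`.
The equation is `d/dt ∫_Ω u(t) ψ + ∫_Ω (a ∇u(t)) · ∇ψ = 0` on `(0,∞)` for every `ψ ∈ C_c^∞(Ω)`,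
in its form integrated over time intervals `[s,t] ⊆ (0,∞)`. -/
structure IsWeakSolution {d : ℕ} (Ω : Opens (Space d)) (a : Space d → Matrix (Fin d) (Fin d) ℂ)
    (u₀ : L2 d) (u : ℝ → L2 d) : Prop where
  continuousOn : ContinuousOn u (Ici 0)
  mem_L2On : ∀ t, 0 ≤ t → u t ∈ L2On Ω
  initial : u 0 = u₀
  equation : ∃ g : ℝ → L2Vec d,
    (∀ δ T : ℝ, 0 < δ → δ < T → MemLp g 2 (volume.restrict (Ioo δ T))) ∧
    (∀ᵐ t ∂(volume.restrict (Ioi (0 : ℝ))), IsH10WithGradient Ω (u t) (g t)) ∧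
    ∀ (ψ : 𝓓(Ω, ℂ)) (s t : ℝ), 0 < s → s ≤ t →
      (∫ x in (Ω : Set (Space d)), u t x * ψ x) - (∫ x in (Ω : Set (Space d)), u s x * ψ x)
        = -∫ r in s..t, ∫ x in (Ω : Set (Space d)), matPair (a x) (g r x) (grad ψ x)

end VaryingDomains

end

noncomputable section

namespace VaryingDomains

open scoped RealInnerProductSpace ComplexConjugate

section Abstract

/-! Encode a solution as `U = (u, ∇u)` with values in the `L_2 × L_2` closure of the pairs `(φ,
∇φ)`. For `Ωn` these closures `V n` increase. A compact subset of `Ω` lies in one `Ωn`, so their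
union is dense in the closure `W` for `Ω`. The equation becomes an abstract one in a real Hilbert
space, since ellipticity only concerns real parts.

Averaging the limit solution twice in time gives a path `Z` that is C¹ into `W`, solves the same
equation and is uniformly `L_2`-close to `u` on `[0,T]`. Let `P n` be the orthogonal projection onto
`V n` for the graph norm. By Dini's theorem `P n Z → Z` and `P n Z' → Z'` uniformly on `[0,T]`
(`tendstoUniformlyOn_norm_sub_starProjection`). The difference of the `n`-th solution and `P n Z`
lies in `V n`, so it is an admissible test vector. Coercivity and Gronwall bound it by the initial
error and the projection errors (`norm_sub_starProjection_sq_le`). `eventually_norm_fst_sub_le`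
combines these bounds. -/

lemma intervalIntegrable_of_continuousOn_Ioi {E : Type*} [NormedAddCommGroup E] {f : ℝ → E}
    (hf : ContinuousOn f (Ioi 0)) {s t : ℝ} (hs : 0 < s) (hst : s ≤ t) :
    IntervalIntegrable f volume s t := by
  apply ContinuousOn.intervalIntegrable
  rw [uIcc_of_le hst]
  exact hf.mono fun r hr => hs.trans_le hr.1

/-! ### Steklov averages in time -/

section Steklov

variable {E F : Type*} [NormedAddCommGroup E] [NormedSpace ℝ E]
  [NormedAddCommGroup F] [NormedSpace ℝ F]

/-- The Steklov average `h⁻¹ ∫_t^{t+h} f` of `f`. -/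
def steklov (h : ℝ) (f : ℝ → E) (t : ℝ) : E := h⁻¹ • ∫ r in t..t + h, f r

lemma integral_add_eq_sub {f : ℝ → E} (hf : ∀ s t, 0 < s → s ≤ t → IntervalIntegrable f volume s t)
    {a t h : ℝ} (ha : 0 < a) (hat : a ≤ t) (hh : 0 ≤ h) :
    ∫ r in t..t + h, f r = (∫ r in a..t + h, f r) - ∫ r in a..t, f r :=
  (intervalIntegral.integral_interval_sub_left (hf a _ ha (by linarith)) (hf a t ha hat)).symm

lemma continuousOn_steklov {f : ℝ → E}
    (hf : ∀ s t, 0 < s → s ≤ t → IntervalIntegrable f volume s t) {h : ℝ} (hh : 0 ≤ h) :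
    ContinuousOn (steklov h f) (Ioi 0) := by
  intro t ht
  apply ContinuousAt.continuousWithinAt
  have ht : 0 < t := ht
  have hc : ContinuousOn (fun s => ∫ r in (t / 2)..s, f r) (Icc (t / 2) (t + h + 1)) := by
    apply intervalIntegral.continuousOn_primitive_interval'
      (hf (t / 2) (t + h + 1) (half_pos ht) (by linarith)) left_mem_uIcc |>.mono
    rw [uIcc_of_le (by linarith)]
  have h1 : ContinuousAt (fun s => ∫ r in (t / 2)..s, f r) t :=
    hc.continuousAt (Icc_mem_nhds (by linarith) (by linarith))
  have h2 : ContinuousAt (fun s => ∫ r in (t / 2)..s + h, f r) t :=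
    ContinuousAt.comp (g := fun s => ∫ r in (t / 2)..s, f r) (f := fun s => s + h)
      (hc.continuousAt (Icc_mem_nhds (by linarith) (by linarith))) (by fun_prop)
  have h3 := (h2.sub h1).const_smul h⁻¹
  refine h3.congr ?_
  filter_upwards [Ioi_mem_nhds (half_lt_self ht)] with s hs
  rw [steklov, integral_add_eq_sub hf (half_pos ht) (le_of_lt hs) hh]
  rfl

variable [CompleteSpace E] [CompleteSpace F]

lemma steklov_comp (L : E →L[ℝ] F) {h t : ℝ} {f : ℝ → E}
    (hf : IntervalIntegrable f volume t (t + h)) :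
    L (steklov h f t) = steklov h (fun r => L (f r)) t := by
  rw [steklov, steklov, map_smul, L.intervalIntegral_comp_comm hf]

lemma norm_steklov_sub_le {h : ℝ} (hh : 0 < h) {f : ℝ → E} {t ε : ℝ} {c : E}
    (hf : IntervalIntegrable f volume t (t + h))
    (hε : ∀ r ∈ Icc t (t + h), ‖f r - c‖ ≤ ε) : ‖steklov h f t - c‖ ≤ ε := by
  have h1 : steklov h f t - c = h⁻¹ • ∫ r in t..t + h, (f r - c) := by
    rw [intervalIntegral.integral_sub hf intervalIntegrable_const, steklov, smul_sub]
    simp [smul_smul, inv_mul_cancel₀ hh.ne']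
  have h2 : ‖∫ r in t..t + h, (f r - c)‖ ≤ ε * |t + h - t| := by
    refine intervalIntegral.norm_integral_le_of_norm_le_const fun r hr => hε r ?_
    rw [uIoc_of_le (by linarith)] at hr
    exact ⟨hr.1.le, hr.2⟩
  rw [h1, norm_smul, norm_inv, Real.norm_of_nonneg hh.le, inv_mul_le_iff₀ hh]
  rw [add_sub_cancel_left, abs_of_pos hh] at h2
  linarith

lemma tendsto_steklov {f : ℝ → E} (hf : ContinuousOn f (Ioi 0)) {t : ℝ} (ht : 0 < t) :
    Tendsto (fun h => steklov h f t) (𝓝[>] 0) (𝓝 (f t)) := by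
  rw [Metric.tendsto_nhds]
  intro ε hε
  have hc := Metric.continuousAt_iff.1 (hf.continuousAt (Ioi_mem_nhds ht)) (ε / 2) (half_pos hε)
  obtain ⟨δ, hδ, hfδ⟩ := hc
  filter_upwards [Ioo_mem_nhdsGT hδ] with h hh
  rw [dist_eq_norm]
  refine (norm_steklov_sub_le hh.1
    (intervalIntegrable_of_continuousOn_Ioi hf ht (by linarith [hh.1])) fun r hr => ?_).trans_lt
    (half_lt_self hε)
  rw [← dist_eq_norm]
  refine (hfδ ?_).le
  rw [Real.dist_eq, abs_of_nonneg (by linarith [hr.1])]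
  linarith [hr.2, hh.2]

lemma hasDerivAt_steklov {f : ℝ → E} (hf : ContinuousOn f (Ioi 0)) {h t : ℝ} (hh : 0 ≤ h)
    (ht : 0 < t) : HasDerivAt (steklov h f) (h⁻¹ • (f (t + h) - f t)) t := by
  have hint := fun s t hs hst => intervalIntegrable_of_continuousOn_Ioi (s := s) (t := t) hf hs hst
  have key : ∀ s, 0 < s → t / 2 ≤ s → HasDerivAt (fun s => ∫ r in (t / 2)..s, f r) (f s) s := by
    intro s hs hts
    refine intervalIntegral.integral_hasDerivAt_right (hint _ _ (by linarith) hts) ?_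
      (hf.continuousAt (Ioi_mem_nhds hs))
    exact hf.stronglyMeasurableAtFilter isOpen_Ioi s hs
  have h1 := (key (t + h) (by linarith) (by linarith)).comp_add_const t h
  have h2 := (h1.sub (key t ht (by linarith))).const_smul h⁻¹
  refine h2.congr_of_eventuallyEq ?_
  filter_upwards [Ioi_mem_nhds (half_lt_self ht)] with s hs
  rw [steklov, integral_add_eq_sub hint (half_pos ht) (le_of_lt hs) hh]
  rfl

end Steklov

/-! ### Abstract evolution equations and their time averages -/

section FormSolution

variable {H G : Type*} [NormedAddCommGroup H] [InnerProductSpace ℝ H]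
  [NormedAddCommGroup G] [InnerProductSpace ℝ G]

/-- An abstract form of the weak evolution equation `u' + D^* A D u = 0` in a Hilbert space. Here
`V ⊆ H × G` is the graph of the restriction of the operator `D` to the form domain, and
`U t = (u t, D u t)`. -/
structure FormSolution (V : Submodule ℝ (WithLp 2 (H × G))) (A : G →L[ℝ] G)
    (U : ℝ → WithLp 2 (H × G)) : Prop where
  intervalIntegrable : ∀ s t, 0 < s → s ≤ t → IntervalIntegrable U volume s t
  mem : ∀ᵐ t ∂(volume.restrict (Ioi (0 : ℝ))), U t ∈ V
  continuousOn_fst : ContinuousOn (fun t => (U t).fst) (Ioi 0)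
  equation : ∀ x ∈ V, ∀ s t : ℝ, 0 < s → s ≤ t →
    ⟪(U t).fst, x.fst⟫ - ⟪(U s).fst, x.fst⟫ = -∫ r in s..t, ⟪A (U r).snd, x.snd⟫

namespace FormSolution

variable {V : Submodule ℝ (WithLp 2 (H × G))} {A : G →L[ℝ] G} {U : ℝ → WithLp 2 (H × G)}

lemma continuousOn_steklov (hU : FormSolution V A U) {h : ℝ} (hh : 0 < h) :
    ContinuousOn (steklov h U) (Ioi 0) :=
  VaryingDomains.continuousOn_steklov hU.intervalIntegrable hh.le

variable [CompleteSpace H] [CompleteSpace G]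

/-- The projection onto `V` commutes with the integral and fixes almost every value of `U`.
Averaging thus turns almost-everywhere membership into membership at every time. -/
lemma steklov_mem [V.HasOrthogonalProjection] (hU : FormSolution V A U) {h t : ℝ}
    (hh : 0 < h) (ht : 0 < t) : steklov h U t ∈ V := by
  rw [← Submodule.starProjection_eq_self_iff,
    steklov_comp _ (hU.intervalIntegrable _ _ ht (by linarith)), steklov, steklov]
  congr 1
  refine intervalIntegral.integral_congr_ae ?_
  have := (ae_restrict_iff' measurableSet_Ioi).1 hU.mem
  filter_upwards [this] with r hr hr'
  rw [uIoc_of_le (by linarith)] at hr'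
  exact Submodule.starProjection_eq_self_iff.2 (hr (ht.trans hr'.1))

lemma steklov_fst (hU : FormSolution V A U) {h t : ℝ} (hh : 0 < h) (ht : 0 < t) :
    (steklov h U t).fst = steklov h (fun r => (U r).fst) t :=
  steklov_comp (WithLp.fstL 2 ℝ H G) (hU.intervalIntegrable _ _ ht (by linarith))

lemma hasDerivAt_steklov_fst (hU : FormSolution V A U) {h t : ℝ} (hh : 0 < h) (ht : 0 < t) :
    HasDerivAt (fun t => (steklov h U t).fst) (h⁻¹ • ((U (t + h)).fst - (U t).fst)) t := by
  refine (hasDerivAt_steklov hU.continuousOn_fst hh.le ht).congr_of_eventuallyEq ?_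
  filter_upwards [Ioi_mem_nhds ht] with s hs
  exact hU.steklov_fst hh hs

/-- The difference quotient is the derivative of the averaged first component, so averages satisfy
the equation pointwise in time. -/
lemma steklov_equation (hU : FormSolution V A U) {h t : ℝ} (hh : 0 < h) (ht : 0 < t)
    {x : WithLp 2 (H × G)} (hx : x ∈ V) :
    ⟪h⁻¹ • ((U (t + h)).fst - (U t).fst), x.fst⟫ = -⟪A (steklov h U t).snd, x.snd⟫ := by
  have hi := hU.intervalIntegrable t (t + h) ht (by linarith)
  have h1 := steklov_comp (innerSL ℝ x.snd ∘L A ∘L WithLp.sndL 2 ℝ H G) hi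
  have h2 : ⟪A (steklov h U t).snd, x.snd⟫ = h⁻¹ * ∫ r in t..t + h, ⟪A (U r).snd, x.snd⟫ := by
    rw [real_inner_comm]
    refine h1.trans ?_
    rw [steklov, smul_eq_mul]
    congr 2
    ext r
    exact real_inner_comm _ _
  rw [real_inner_smul_left, inner_sub_left, hU.equation x hx t (t + h) ht (by linarith), h2]
  ring

lemma steklov [V.HasOrthogonalProjection] (hU : FormSolution V A U) {h : ℝ} (hh : 0 < h) :
    FormSolution V A (steklov h U) where
  intervalIntegrable s t hs hst :=
    intervalIntegrable_of_continuousOn_Ioi (hU.continuousOn_steklov hh) hs hst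
  mem := (ae_restrict_iff' measurableSet_Ioi).2 (.of_forall fun _ ht => hU.steklov_mem hh ht)
  continuousOn_fst :=
    (WithLp.fstL 2 ℝ H G).continuous.comp_continuousOn (hU.continuousOn_steklov hh)
  equation x hx s t hs hst := by
    have hpos : ∀ r ∈ uIcc s t, 0 < r := fun r hr => by
      rw [uIcc_of_le hst] at hr
      exact hs.trans_le hr.1
    rw [← intervalIntegral.integral_neg]
    symm
    refine intervalIntegral.integral_eq_sub_of_hasDerivAt
      (f := fun r => ⟪(VaryingDomains.steklov h U r).fst, x.fst⟫) (fun r hr => ?_) ?_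
    · rw [← hU.steklov_equation hh (hpos r hr) hx]
      simpa using (hU.hasDerivAt_steklov_fst hh (hpos r hr)).inner ℝ (hasDerivAt_const r x.fst)
    · apply ContinuousOn.intervalIntegrable
      have h1 : ContinuousOn (VaryingDomains.steklov h U) (uIcc s t) :=
        (hU.continuousOn_steklov hh).mono hpos
      have h2 := (A ∘L WithLp.sndL 2 ℝ H G).continuous.comp_continuousOn h1
      exact (h2.inner continuousOn_const).neg

end FormSolution

end FormSolution

/-! ### Gronwall's inequality and the energy estimate -/

lemma le_exp_mul_of_deriv_le {y y' : ℝ → ℝ} {c s t : ℝ} (hst : s ≤ t)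
    (hy : ∀ r ∈ Icc s t, HasDerivAt y (y' r) r) (hle : ∀ r ∈ Icc s t, y' r ≤ y r + c) :
    y t + c ≤ Real.exp (t - s) * (y s + c) := by
  have hd : ∀ r ∈ Icc s t, HasDerivAt (fun r => Real.exp (s - r) * (y r + c))
      (Real.exp (s - r) * (-1) * (y r + c) + Real.exp (s - r) * y' r) r := fun r hr =>
    (((hasDerivAt_id r).const_sub s).exp).mul ((hy r hr).add_const c)
  have hanti : AntitoneOn (fun r => Real.exp (s - r) * (y r + c)) (Icc s t) := by
    refine antitoneOn_of_hasDerivWithinAt_nonpos (convex_Icc s t)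
      (fun r hr => (hd r hr).continuousAt.continuousWithinAt)
      (fun r hr => (hd r (interior_subset hr)).hasDerivWithinAt) fun r hr => ?_
    have := hle r (interior_subset hr)
    nlinarith [Real.exp_pos (s - r)]
  have h := hanti (left_mem_Icc.2 hst) (right_mem_Icc.2 hst) hst
  simp only [sub_self, Real.exp_zero, one_mul] at h
  calc y t + c = Real.exp (t - s) * (Real.exp (s - t) * (y t + c)) := by
        rw [← mul_assoc, ← Real.exp_add]; simp
    _ ≤ _ := by gcongr

variable {H G : Type*} [NormedAddCommGroup H] [InnerProductSpace ℝ H] [CompleteSpace H]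
  [NormedAddCommGroup G] [InnerProductSpace ℝ G] [CompleteSpace G]

namespace FormSolution

variable {V : Submodule ℝ (WithLp 2 (H × G))} {A : G →L[ℝ] G} {U : ℝ → WithLp 2 (H × G)}

/-- Comparison of a solution in `V` with the projection to `V` of a strong solution in a larger
space. -/
lemma norm_sub_starProjection_sq_le [V.HasOrthogonalProjection] (hU : FormSolution V A U)
    {η : ℝ} (hη : 0 < η) (hA : ∀ x ∈ V, η * ‖x.snd‖ ^ 2 ≤ ⟪A x.snd, x.snd⟫)
    {Z Z' : ℝ → WithLp 2 (H × G)} {T δ : ℝ}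
    (hZ : ∀ t ∈ Icc 0 T, HasDerivAt Z (Z' t) t)
    (hZeq : ∀ t ∈ Icc 0 T, ∀ x ∈ V, ⟪(Z' t).fst, x.fst⟫ = -⟪A (Z t).snd, x.snd⟫)
    (hδ : ∀ t ∈ Icc 0 T, ‖Z t - V.starProjection (Z t)‖ ≤ δ)
    (hδ' : ∀ t ∈ Icc 0 T, ‖Z' t - V.starProjection (Z' t)‖ ≤ δ)
    {s t : ℝ} (hs : 0 < s) (hst : s ≤ t) (htT : t ≤ T) :
    ‖(U t - V.starProjection (Z t)).fst‖ ^ 2 + (‖A‖ ^ 2 / (2 * η) + 1) * δ ^ 2 ≤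
      Real.exp (t - s) * (‖(U s - V.starProjection (Z s)).fst‖ ^ 2
        + (‖A‖ ^ 2 / (2 * η) + 1) * δ ^ 2) := by
  set c : ℝ := (‖A‖ ^ 2 / (2 * η) + 1) * δ ^ 2
  -- `U` need not be differentiable in time, so the estimate is proved for its averages; `k → 0`
  -- recovers `U`.
  have strong : ∀ k : ℝ, 0 < k →
      ‖(VaryingDomains.steklov k U t - V.starProjection (Z t)).fst‖ ^ 2 + c ≤ Real.exp (t - s) *
        (‖(VaryingDomains.steklov k U s - V.starProjection (Z s)).fst‖ ^ 2 + c) := by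
    intro k hk
    set w : ℝ → WithLp 2 (H × G) := fun r => VaryingDomains.steklov k U r - V.starProjection (Z r)
    have hw : ∀ r ∈ Icc s t, HasDerivAt (fun r => (w r).fst)
        (k⁻¹ • ((U (r + k)).fst - (U r).fst) - (V.starProjection (Z' r)).fst) r := by
      intro r hr
      refine (hU.hasDerivAt_steklov_fst hk (hs.trans_le hr.1)).sub ?_
      exact (WithLp.fstL 2 ℝ H G ∘L V.starProjection).hasFDerivAt.comp_hasDerivAt r
        (hZ r ⟨hs.le.trans hr.1, hr.2.trans htT⟩)
    refine le_exp_mul_of_deriv_le hst (fun r hr => (hw r hr).norm_sq) fun r hr => ?_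
    have hr0 : 0 < r := hs.trans_le hr.1
    have hrT : r ∈ Icc 0 T := ⟨hr0.le, hr.2.trans htT⟩
    have hwV : w r ∈ V := V.sub_mem (hU.steklov_mem hk hr0) (V.starProjection_apply_mem _)
    set e := Z r - V.starProjection (Z r)
    set e' := Z' r - V.starProjection (Z' r)
    -- Test both equations with `w r ∈ V` and subtract; replacing `Z` and `Z'` by their projections
    -- leaves only the terms in `e` and `e'`.
    have hid : ⟪(w r).fst, k⁻¹ • ((U (r + k)).fst - (U r).fst) - (V.starProjection (Z' r)).fst⟫ =
        -⟪A (w r).snd, (w r).snd⟫ + ⟪A e.snd, (w r).snd⟫ + ⟪e'.fst, (w r).fst⟫ := by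
      have h1 := hU.steklov_equation hk hr0 hwV
      have h2 := hZeq r hrT _ hwV
      have h3 : (VaryingDomains.steklov k U r).snd = (w r).snd + (Z r).snd - e.snd := by
        simp only [w, e, WithLp.sub_snd]; abel
      have h4 : (V.starProjection (Z' r)).fst = (Z' r).fst - e'.fst := by
        simp only [e', WithLp.sub_fst]; abel
      rw [real_inner_comm, inner_sub_left, h1, h3, h4, inner_sub_left, h2, map_sub, map_add,
        inner_sub_left, inner_add_left]
      ring
    have hc := hA _ hwV
    have he : ‖e.snd‖ ≤ δ := (WithLp.norm_snd_le _ e).trans (hδ r hrT)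
    have he' : ‖e'.fst‖ ≤ δ := (WithLp.norm_fst_le _ e').trans (hδ' r hrT)
    have hδ0 : 0 ≤ δ := (norm_nonneg _).trans he
    have hb1 : ⟪A e.snd, (w r).snd⟫ ≤ ‖A‖ * δ * ‖(w r).snd‖ := by
      refine (real_inner_le_norm _ _).trans ?_
      gcongr
      exact (A.le_opNorm _).trans (by gcongr)
    have hb2 : ⟪e'.fst, (w r).fst⟫ ≤ δ * ‖(w r).fst‖ :=
      (real_inner_le_norm _ _).trans (by gcongr)
    rw [hid]
    -- Young's inequality, weighted so that coercivity absorbs the gradient term exactly.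
    have hyoung : 2 * (‖A‖ * δ * ‖(w r).snd‖) ≤
        2 * (η * ‖(w r).snd‖ ^ 2) + ‖A‖ ^ 2 / (2 * η) * δ ^ 2 := by
      have : 0 ≤ (2 * η * ‖(w r).snd‖ - ‖A‖ * δ) ^ 2 / (2 * η) := by positivity
      have h5 : (2 * η * ‖(w r).snd‖ - ‖A‖ * δ) ^ 2 / (2 * η) =
        2 * (η * ‖(w r).snd‖ ^ 2) + ‖A‖ ^ 2 / (2 * η) * δ ^ 2 - 2 * (‖A‖ * δ * ‖(w r).snd‖) := by
        field_simp
        ring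
      linarith
    have : c = ‖A‖ ^ 2 / (2 * η) * δ ^ 2 + δ ^ 2 := by simp only [c]; ring
    nlinarith [sq_nonneg (δ - ‖(w r).fst‖)]
  have lim : ∀ r, 0 < r → Tendsto
      (fun k => ‖(VaryingDomains.steklov k U r - V.starProjection (Z r)).fst‖ ^ 2 + c) (𝓝[>] 0)
      (𝓝 (‖(U r - V.starProjection (Z r)).fst‖ ^ 2 + c)) := by
    intro r hr
    have h1 := tendsto_steklov hU.continuousOn_fst hr
    have h2 : Tendsto (fun k => (VaryingDomains.steklov k U r).fst) (𝓝[>] 0) (𝓝 (U r).fst) := by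
      refine h1.congr' ?_
      filter_upwards [self_mem_nhdsWithin] with k hk
      exact (hU.steklov_fst hk hr).symm
    simp only [WithLp.sub_fst]
    exact ((h2.sub_const _).norm.pow 2).add_const c
  refine le_of_tendsto_of_tendsto (lim t (hs.trans_le hst)) ((lim s hs).const_mul _) ?_
  filter_upwards [self_mem_nhdsWithin] with k hk
  exact strong k hk

/-- The equation is only available at positive times; the initial value enters by letting `s ↓ 0`,
using continuity of the first component at `0`. -/
lemma norm_sub_starProjection_sq_le_of_zero [V.HasOrthogonalProjection] (hU : FormSolution V A U)
    (hU0 : ContinuousWithinAt (fun t => (U t).fst) (Ioi 0) 0)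
    {η : ℝ} (hη : 0 < η) (hA : ∀ x ∈ V, η * ‖x.snd‖ ^ 2 ≤ ⟪A x.snd, x.snd⟫)
    {Z Z' : ℝ → WithLp 2 (H × G)} {T δ : ℝ}
    (hZ : ∀ t ∈ Icc 0 T, HasDerivAt Z (Z' t) t)
    (hZeq : ∀ t ∈ Icc 0 T, ∀ x ∈ V, ⟪(Z' t).fst, x.fst⟫ = -⟪A (Z t).snd, x.snd⟫)
    (hδ : ∀ t ∈ Icc 0 T, ‖Z t - V.starProjection (Z t)‖ ≤ δ)
    (hδ' : ∀ t ∈ Icc 0 T, ‖Z' t - V.starProjection (Z' t)‖ ≤ δ)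
    {t : ℝ} (ht : t ∈ Icc 0 T) :
    ‖(U t - V.starProjection (Z t)).fst‖ ^ 2 ≤
      Real.exp T * (‖(U 0 - V.starProjection (Z 0)).fst‖ ^ 2
        + (‖A‖ ^ 2 / (2 * η) + 1) * δ ^ 2) := by
  set c : ℝ := (‖A‖ ^ 2 / (2 * η) + 1) * δ ^ 2
  have hc : 0 ≤ c := by positivity
  have h0 : 0 ∈ Icc 0 T := ⟨le_rfl, ht.1.trans ht.2⟩
  have hT : 1 ≤ Real.exp T := Real.one_le_exp h0.2
  rcases ht.1.eq_or_lt with rfl | htpos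
  · nlinarith [sq_nonneg ‖(U 0 - V.starProjection (Z 0)).fst‖]
  have hlim : Tendsto (fun s => ‖(U s - V.starProjection (Z s)).fst‖ ^ 2) (𝓝[>] 0)
      (𝓝 (‖(U 0 - V.starProjection (Z 0)).fst‖ ^ 2)) := by
    have hZ0 : Tendsto (fun s => (V.starProjection (Z s)).fst) (𝓝[>] 0)
        (𝓝 (V.starProjection (Z 0)).fst) :=
      ((WithLp.fstL 2 ℝ H G ∘L V.starProjection).continuous.continuousAt.comp
        (hZ 0 h0).continuousAt).continuousWithinAt
    simp only [WithLp.sub_fst]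
    exact ((hU0.sub hZ0).norm.pow 2)
  refine ge_of_tendsto ((hlim.add_const c).const_mul (Real.exp T)) ?_
  filter_upwards [Ioc_mem_nhdsGT htpos] with s hs
  have h := hU.norm_sub_starProjection_sq_le hη hA hZ hZeq hδ hδ' hs.1 hs.2 ht.2
  refine le_trans (by linarith) (h.trans ?_)
  gcongr
  linarith [ht.2, hs.1]

end FormSolution

/-! ### Projections onto an increasing sequence of subspaces -/

lemma antitone_norm_sub_starProjection {E : Type*} [NormedAddCommGroup E] [InnerProductSpace ℝ E]
    {V : ℕ → Submodule ℝ E} [∀ n, (V n).HasOrthogonalProjection] (hV : Monotone V) (x : E) :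
    Antitone fun n => ‖x - (V n).starProjection x‖ := by
  intro m n hmn
  simp only
  rw [Submodule.starProjection_minimal]
  exact ciInf_le ⟨0, by rintro _ ⟨y, rfl⟩; positivity⟩
    (⟨_, hV hmn ((V m).starProjection_apply_mem x)⟩ : V n)

/-- Dini's theorem: the distances to `V n` are continuous in `t`, decrease in `n` and tend to `0`
pointwise. -/
lemma tendstoUniformlyOn_norm_sub_starProjection {E : Type*} [NormedAddCommGroup E]
    [InnerProductSpace ℝ E] [CompleteSpace E] {V : ℕ → Submodule ℝ E}
    [∀ n, (V n).HasOrthogonalProjection] (hV : Monotone V) {Z : ℝ → E} {s : Set ℝ}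
    (hs : IsCompact s) (hZ : ContinuousOn Z s)
    (hmem : ∀ t ∈ s, Z t ∈ (⨆ n, V n).topologicalClosure) {ε : ℝ} (hε : 0 < ε) :
    ∀ᶠ n in atTop, ∀ t ∈ s, ‖Z t - (V n).starProjection (Z t)‖ ≤ ε := by
  have : CompleteSpace (⨆ n, V n).topologicalClosure :=
    (⨆ n, V n).isClosed_topologicalClosure.completeSpace_coe
  have hu := Antitone.tendstoUniformlyOn_of_forall_tendsto
    (F := fun n t => ‖Z t - (V n).starProjection (Z t)‖) (f := fun _ => (0 : ℝ)) hs
    (fun n => (hZ.sub ((V n).starProjection.continuous.comp_continuousOn hZ)).norm)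
    (fun t _ => antitone_norm_sub_starProjection hV (Z t)) continuousOn_const fun t ht => by
      have h := Submodule.starProjection_tendsto_closure_iSup V hV (Z t)
      rw [Submodule.starProjection_eq_self_iff.2 (hmem t ht)] at h
      simpa using (h.const_sub (Z t)).norm
  filter_upwards [Metric.tendstoUniformlyOn_iff.1 hu ε hε] with n hn t ht
  simpa using (hn t ht).le

/-! ### The abstract convergence theorem -/

/-- Convergence of solutions of abstract evolution equations on an increasing sequence of form
domains. -/
theorem eventually_norm_fst_sub_le {V : ℕ → Submodule ℝ (WithLp 2 (H × G))}
    {W : Submodule ℝ (WithLp 2 (H × G))} [∀ n, (V n).HasOrthogonalProjection]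
    [W.HasOrthogonalProjection] (hV : Monotone V) (hVW : ∀ n, V n ≤ W)
    (hWV : W ≤ (⨆ n, V n).topologicalClosure) {A : G →L[ℝ] G} {η : ℝ} (hη : 0 < η)
    (hA : ∀ x ∈ W, η * ‖x.snd‖ ^ 2 ≤ ⟪A x.snd, x.snd⟫)
    {Un : ℕ → ℝ → WithLp 2 (H × G)} (hUn : ∀ n, FormSolution (V n) A (Un n))
    (hUnc : ∀ n, ContinuousOn (fun t => (Un n t).fst) (Ici 0))
    {U : ℝ → WithLp 2 (H × G)} (hU : FormSolution W A U)
    (hUc : ContinuousOn (fun t => (U t).fst) (Ici 0))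
    (hlim : Tendsto (fun n => ‖(Un n 0).fst - (U 0).fst‖) atTop (𝓝 0))
    {T : ℝ} (hT : 0 < T) {ε : ℝ} (hε : 0 < ε) :
    ∀ᶠ n in atTop, ∀ t ∈ Icc 0 T, ‖(Un n t).fst - (U t).fst‖ ≤ ε := by
  -- The `10` is `3 ^ 2 + 1`: the initial error is at most `3 * δ`, and the Gronwall constant
  -- contributes the `1`. The final bound is `K * δ + 2 * δ = ε`.
  set K : ℝ := Real.sqrt (Real.exp T * (10 + ‖A‖ ^ 2 / (2 * η)))
  have hK : 0 ≤ K := Real.sqrt_nonneg _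
  have hK2 : K ^ 2 = Real.exp T * (10 + ‖A‖ ^ 2 / (2 * η)) := Real.sq_sqrt (by positivity)
  set δ : ℝ := ε / (K + 2)
  have hδ : 0 < δ := by positivity
  have huc := isCompact_Icc.uniformContinuousOn_of_continuous
    (hUc.mono (Icc_subset_Ici_self : Icc 0 (T + 1) ⊆ Ici 0))
  obtain ⟨ρ, hρ, hUρ⟩ := Metric.uniformContinuousOn_iff.1 huc δ hδ
  -- The shift and the two averages look ahead by at most `3 * h`, which must stay below `ρ` and
  -- inside `[0, T + 1]`.
  obtain ⟨h, hh, hhρ⟩ : ∃ h : ℝ, 0 < h ∧ 3 * h < min ρ 1 :=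
    ⟨min ρ 1 / 4, by positivity, by linarith [lt_min hρ one_pos]⟩
  have hS : FormSolution W A (steklov h U) := hU.steklov hh
  -- The first average makes `U` continuous in the graph norm, the second makes it C¹. The shift by
  -- `h` keeps all times positive, so that `Z` is regular up to `t = 0`.
  set Z : ℝ → WithLp 2 (H × G) := fun t => steklov h (steklov h U) (t + h)
  set Z' : ℝ → WithLp 2 (H × G) := fun t => h⁻¹ • (steklov h U (t + h + h) - steklov h U (t + h))
  have hpos : ∀ t ∈ Icc 0 T, 0 < t + h := fun t ht => by linarith [ht.1]
  have hZ : ∀ t ∈ Icc 0 T, HasDerivAt Z (Z' t) t := fun t ht =>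
    (hasDerivAt_steklov (hU.continuousOn_steklov hh) hh.le (hpos t ht)).comp_add_const t h
  have hZeq : ∀ t ∈ Icc 0 T, ∀ x ∈ W, ⟪(Z' t).fst, x.fst⟫ = -⟪A (Z t).snd, x.snd⟫ :=
    fun t ht x hx => hS.steklov_equation hh (hpos t ht) hx
  have hZc : ContinuousOn Z (Icc 0 T) := fun t ht => (hZ t ht).continuousAt.continuousWithinAt
  have hZc' : ContinuousOn Z' (Icc 0 T) := by
    have hc := hU.continuousOn_steklov hh
    have h1 : ContinuousOn (fun t => steklov h U (t + h + h)) (Icc 0 T) :=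
      hc.comp (by fun_prop) fun t ht => add_pos (hpos t ht) hh
    have h2 : ContinuousOn (fun t => steklov h U (t + h)) (Icc 0 T) :=
      hc.comp (by fun_prop) hpos
    exact (h1.sub h2).const_smul h⁻¹
  have hZW : ∀ t ∈ Icc 0 T, Z t ∈ W := fun t ht => hS.steklov_mem hh (hpos t ht)
  have hZW' : ∀ t ∈ Icc 0 T, Z' t ∈ W := fun t ht =>
    W.smul_mem _ (W.sub_mem (hU.steklov_mem hh (add_pos (hpos t ht) hh))
      (hU.steklov_mem hh (hpos t ht)))
  have hUZ : ∀ t ∈ Icc 0 T, ‖(Z t).fst - (U t).fst‖ ≤ δ := by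
    intro t ht
    rw [hS.steklov_fst hh (hpos t ht)]
    refine norm_steklov_sub_le hh
      (intervalIntegrable_of_continuousOn_Ioi hS.continuousOn_fst (hpos t ht) (by linarith))
      fun r hr => ?_
    have hr0 : 0 < r := (hpos t ht).trans_le hr.1
    rw [hU.steklov_fst hh hr0]
    refine norm_steklov_sub_le hh
      (intervalIntegrable_of_continuousOn_Ioi hU.continuousOn_fst hr0 (by linarith))
      fun q hq => ?_
    rw [← dist_eq_norm]
    have h1 := hhρ.trans_le (min_le_left _ _)
    have h2 := hhρ.trans_le (min_le_right _ _)
    refine (hUρ q ⟨hr0.le.trans hq.1, by linarith [hq.2, hr.2, ht.2]⟩ t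
      ⟨ht.1, by linarith [ht.2]⟩ ?_).le
    rw [Real.dist_eq, abs_of_nonneg (by linarith [hq.1, hr.1])]
    linarith [hq.2, hr.2]
  filter_upwards [hlim.eventually_le_const hδ,
    tendstoUniformlyOn_norm_sub_starProjection hV isCompact_Icc hZc
      (fun t ht => hWV (hZW t ht)) hδ,
    tendstoUniformlyOn_norm_sub_starProjection hV isCompact_Icc hZc'
      (fun t ht => hWV (hZW' t ht)) hδ] with n hn0 hn hn' t ht
  have hest := (hUn n).norm_sub_starProjection_sq_le_of_zero
    ((hUnc n 0 self_mem_Ici).mono Ioi_subset_Ici_self) hη (fun x hx => hA x (hVW n hx)) hZ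
    (fun t ht x hx => hZeq t ht x (hVW n hx)) hn hn' ht
  have hPfst : ∀ t ∈ Icc 0 T, ‖(Z t).fst - ((V n).starProjection (Z t)).fst‖ ≤ δ := fun t ht =>
    (WithLp.norm_fst_le _ _).trans (hn t ht)
  have h0 : (0 : ℝ) ∈ Icc 0 T := ⟨le_rfl, hT.le⟩
  have hw0 : ‖(Un n 0 - (V n).starProjection (Z 0)).fst‖ ≤ 3 * δ := by
    have : (Un n 0 - (V n).starProjection (Z 0)).fst = ((Un n 0).fst - (U 0).fst) -
        ((Z 0).fst - (U 0).fst) + ((Z 0).fst - ((V n).starProjection (Z 0)).fst) := by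
      rw [WithLp.sub_fst]; abel
    rw [this]
    refine (norm_add_le _ _).trans ?_
    linarith [norm_sub_le ((Un n 0).fst - (U 0).fst) ((Z 0).fst - (U 0).fst), hUZ 0 h0, hPfst 0 h0]
  have hwt : ‖(Un n t - (V n).starProjection (Z t)).fst‖ ≤ K * δ := by
    refine le_of_sq_le_sq ?_ (by positivity)
    calc _ ≤ _ := hest
      _ ≤ Real.exp T * ((3 * δ) ^ 2 + (‖A‖ ^ 2 / (2 * η) + 1) * δ ^ 2) := by gcongr
      _ = (K * δ) ^ 2 := by rw [mul_pow K, hK2]; ring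
  have : (Un n t).fst - (U t).fst = (Un n t - (V n).starProjection (Z t)).fst -
      ((Z t).fst - ((V n).starProjection (Z t)).fst) + ((Z t).fst - (U t).fst) := by
    rw [WithLp.sub_fst]; abel
  rw [this]
  refine (norm_add_le _ _).trans ?_
  have hfin : K * δ + 2 * δ = ε := by simp only [δ]; field_simp
  linarith [norm_sub_le (Un n t - (V n).starProjection (Z t)).fst
    ((Z t).fst - ((V n).starProjection (Z t)).fst), hUZ t ht, hPfst t ht]

end Abstract

variable {d : ℕ}

/-! ### Classical gradients -/

section Gradient

lemma grad_eq_comp (φ : Space d → ℂ) :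
    grad φ = (fun L : Space d →L[ℝ] ℂ =>
      (WithLp.toLp 2 fun i => L (EuclideanSpace.single i 1) : EuclideanSpace ℂ (Fin d))) ∘
        fderiv ℝ φ := rfl

lemma continuous_grad {φ : Space d → ℂ} (hφ : ContDiff ℝ 1 φ) : Continuous (grad φ) := by
  have := hφ.continuous_fderiv one_ne_zero
  unfold grad
  fun_prop

lemma hasCompactSupport_grad {φ : Space d → ℂ} (hφ : HasCompactSupport φ) :
    HasCompactSupport (grad φ) := by
  rw [grad_eq_comp]
  exact (hφ.fderiv ℝ).comp_left (by ext i; simp)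

lemma grad_eq_zero_of_notMem_tsupport {φ : Space d → ℂ} {x : Space d} (hx : x ∉ tsupport φ) :
    grad φ x = 0 := by
  have : fderiv ℝ φ x = 0 := by
    by_contra h
    exact hx (support_fderiv_subset ℝ h)
  ext i
  simp [grad, this]

lemma grad_add {φ ψ : Space d → ℂ} (hφ : Differentiable ℝ φ) (hψ : Differentiable ℝ ψ) :
    grad (φ + ψ) = grad φ + grad ψ := by
  ext x i
  simp [grad, fderiv_add (hφ x) (hψ x)]

lemma grad_const_smul {φ : Space d → ℂ} (hφ : Differentiable ℝ φ) (c : ℝ) :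
    grad (c • φ) = c • grad φ := by
  ext x i
  simp [grad, fderiv_const_smul (hφ x) c]

lemma grad_conj_apply {φ : Space d → ℂ} (hφ : Differentiable ℝ φ) (x : Space d) (i : Fin d) :
    grad (fun y => conj (φ y)) x i = conj (grad φ x i) := by
  have h := Complex.conjCLE.toContinuousLinearMap.hasFDerivAt.comp x (hφ x).hasFDerivAt
  have h' : fderiv ℝ (fun y => conj (φ y)) x =
      Complex.conjCLE.toContinuousLinearMap.comp (fderiv ℝ φ x) := h.fderiv
  simp [grad, h']

end Gradient

/-! ### Test functions and the form domains -/

section TestFunctions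

variable {Ω Ω' : Opens (Space d)}

lemma TestFunction.differentiable (φ : 𝓓(Ω, ℂ)) : Differentiable ℝ φ :=
  φ.contDiff.differentiable (by simp)

lemma TestFunction.eq_zero_of_notMem (φ : 𝓓(Ω, ℂ)) {x : Space d} (hx : x ∉ Ω) : φ x = 0 :=
  image_eq_zero_of_notMem_tsupport fun h => hx (φ.tsupport_subset h)

lemma TestFunction.grad_eq_zero_of_notMem (φ : 𝓓(Ω, ℂ)) {x : Space d} (hx : x ∉ Ω) :
    grad φ x = 0 :=
  grad_eq_zero_of_notMem_tsupport fun h => hx (φ.tsupport_subset h)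

lemma TestFunction.memLp (φ : 𝓓(Ω, ℂ)) : MemLp φ 2 (volume : Measure (Space d)) :=
  φ.continuous.memLp_of_hasCompactSupport φ.hasCompactSupport

lemma TestFunction.memLp_grad (φ : 𝓓(Ω, ℂ)) : MemLp (grad φ) 2 (volume : Measure (Space d)) :=
  (continuous_grad (φ.contDiff.of_le (by simp))).memLp_of_hasCompactSupport
    (hasCompactSupport_grad φ.hasCompactSupport)

/-- The complex conjugate of a test function. -/
def TestFunction.conj (φ : 𝓓(Ω, ℂ)) : 𝓓(Ω, ℂ) where
  toFun x := starRingEnd ℂ (φ x)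
  contDiff' := Complex.conjCLE.contDiff.comp φ.contDiff
  hasCompactSupport' := φ.hasCompactSupport.comp_left (map_zero _)
  tsupport_subset' := (closure_mono fun x hx => by
    contrapose! hx; simp_all).trans φ.tsupport_subset

/-- The pairs `(φ, ∇φ)` with `φ ∈ C_c^∞(Ω)`. -/
def testSpace (Ω : Opens (Space d)) : Submodule ℝ (WithLp 2 (L2 d × L2Vec d)) where
  carrier := {x | ∃ φ : 𝓓(Ω, ℂ), x.fst =ᵐ[volume] φ ∧ x.snd =ᵐ[volume] grad φ}
  zero_mem' := by
    refine ⟨0, Lp.coeFn_zero _ _ _, (Lp.coeFn_zero _ _ _).trans (.of_eq ?_)⟩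
    ext x i
    simp [grad, FunLike.coe_zero]
  add_mem' := by
    rintro x y ⟨φ, hφ, hφ'⟩ ⟨ψ, hψ, hψ'⟩
    refine ⟨φ + ψ, (Lp.coeFn_add _ _).trans (hφ.add hψ), ?_⟩
    rw [FunLike.coe_add, grad_add (TestFunction.differentiable φ) (TestFunction.differentiable ψ)]
    exact (Lp.coeFn_add _ _).trans (hφ'.add hψ')
  smul_mem' := by
    rintro c x ⟨φ, hφ, hφ'⟩
    refine ⟨c • φ, (Lp.coeFn_smul _ _).trans (hφ.const_smul c), ?_⟩
    rw [FunLike.coe_smul, grad_const_smul (TestFunction.differentiable φ)]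
    exact (Lp.coeFn_smul _ _).trans (hφ'.const_smul c)

lemma testSpace_mono (h : Ω ≤ Ω') : testSpace Ω ≤ testSpace Ω' := by
  rintro x ⟨φ, hφ⟩
  exact ⟨⟨φ, φ.contDiff, φ.hasCompactSupport, φ.tsupport_subset.trans h⟩, hφ⟩

lemma testSpace_le_iSup {Ωn : ℕ → Opens (Space d)} (hmono : Monotone Ωn)
    (hΩ : (Ω : Set (Space d)) = ⋃ n, (Ωn n : Set (Space d))) :
    testSpace Ω ≤ ⨆ n, testSpace (Ωn n) := by
  rintro x ⟨φ, hφ⟩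
  obtain ⟨n, hn⟩ := φ.hasCompactSupport.isCompact.elim_directed_cover
    (fun n => (Ωn n : Set (Space d))) (fun n => (Ωn n).isOpen) (hΩ ▸ φ.tsupport_subset)
    (directed_of_isDirected_le hmono)
  exact Submodule.mem_iSup_of_mem n ⟨⟨φ, φ.contDiff, φ.hasCompactSupport, hn⟩, hφ⟩

lemma IsH10WithGradient.mem_closure_testSpace {f : L2 d} {g : L2Vec d}
    (h : IsH10WithGradient Ω f g) :
    WithLp.toLp 2 (f, g) ∈ (testSpace Ω).topologicalClosure := by
  refine Metric.mem_closure_iff.2 fun ε hε => ?_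
  obtain ⟨φ, h1, h2⟩ := h.approx (ENNReal.ofReal (ε / 2)) (by simpa using hε)
  have hφ := TestFunction.memLp φ
  have hφ' := TestFunction.memLp_grad φ
  refine ⟨WithLp.toLp 2 (hφ.toLp, hφ'.toLp), ⟨φ, hφ.coeFn_toLp, hφ'.coeFn_toLp⟩, ?_⟩
  have d1 : ‖f - hφ.toLp‖ < ε / 2 := by
    rw [Lp.norm_def, eLpNorm_congr_ae ((Lp.coeFn_sub _ _).trans (.sub .rfl hφ.coeFn_toLp))]
    exact ENNReal.toReal_lt_of_lt_ofReal h1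
  have d2 : ‖g - hφ'.toLp‖ < ε / 2 := by
    rw [Lp.norm_def, eLpNorm_congr_ae ((Lp.coeFn_sub _ _).trans (.sub .rfl hφ'.coeFn_toLp))]
    exact ENNReal.toReal_lt_of_lt_ofReal h2
  rw [dist_eq_norm, ← WithLp.toLp_sub, Prod.mk_sub_mk]
  refine lt_of_pow_lt_pow_left₀ 2 hε.le ?_
  rw [WithLp.prod_norm_sq_eq_of_L2]
  change ‖f - hφ.toLp‖ ^ 2 + ‖g - hφ'.toLp‖ ^ 2 < ε ^ 2
  nlinarith [norm_nonneg (f - hφ.toLp), norm_nonneg (g - hφ'.toLp)]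

end TestFunctions

/-! ### The coefficient operator and its coercivity -/

section Coefficients

/-- The operator on `ℂ^d` given by a matrix, as a continuous linear map. -/
def matrixCLM (M : Matrix (Fin d) (Fin d) ℂ) :
    EuclideanSpace ℂ (Fin d) →L[ℂ] EuclideanSpace ℂ (Fin d) :=
  ∑ i, ∑ j, ContinuousLinearMap.toSpanSingleton ℂ
    ((EuclideanSpace.proj j : EuclideanSpace ℂ (Fin d) →L[ℂ] ℂ).smulRight
      (EuclideanSpace.single i 1)) (M i j)

lemma matrixCLM_apply (M : Matrix (Fin d) (Fin d) ℂ) (ξ : EuclideanSpace ℂ (Fin d)) (i : Fin d) :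
    matrixCLM M ξ i = ∑ j, M i j * ξ j := by
  simp [matrixCLM, sum_apply, Finset.sum_apply, Pi.single_apply]

lemma inner_matrixCLM (M : Matrix (Fin d) (Fin d) ℂ) (ξ ζ : EuclideanSpace ℂ (Fin d)) :
    inner ℂ ζ (matrixCLM M ξ) = ∑ i, ∑ j, M i j * ξ j * conj (ζ i) := by
  simp [PiLp.inner_apply, matrixCLM_apply, Finset.sum_mul]

lemma real_inner_eq_re_inner_complex (x y : ℂ) : ⟪x, y⟫ = (inner ℂ y x).re := by
  rw [Complex.inner, RCLike.inner_apply, ← Complex.conj_re]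
  simp only [map_mul, Complex.conj_conj, mul_comm]

lemma real_inner_eq_re_inner_euclidean (x y : EuclideanSpace ℂ (Fin d)) :
    ⟪x, y⟫ = (inner ℂ y x).re := by
  simp only [PiLp.inner_apply, Complex.re_sum, real_inner_eq_re_inner_complex]

lemma Lp.real_inner_eq_re_inner {α F : Type*} [MeasurableSpace α] {μ : Measure α}
    [NormedAddCommGroup F] [InnerProductSpace ℂ F] [InnerProductSpace ℝ F]
    (hF : ∀ x y : F, ⟪x, y⟫ = (inner ℂ y x).re) (f g : Lp F 2 μ) :
    ⟪f, g⟫ = (inner ℂ g f).re := by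
  rw [L2.inner_def, L2.inner_def]
  simp only [hF]
  exact integral_re (L2.integrable_inner (𝕜 := ℂ) g f)

lemma memLp_sum_toSpanSingleton {α F ι : Type*} [Fintype ι] [MeasurableSpace α] {μ : Measure α}
    {p : ℝ≥0∞} [NormedAddCommGroup F] [NormedSpace ℂ F] (y : ι → ι → F) {f : α → ι → ι → ℂ}
    (hf : ∀ i j, MemLp (fun x => f x i j) p μ) :
    MemLp (fun x => ∑ i, ∑ j, ContinuousLinearMap.toSpanSingleton ℂ (y i j) (f x i j)) p μ :=
  memLp_finsetSum _ fun i _ => memLp_finsetSum _ fun j _ =>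
    (ContinuousLinearMap.toSpanSingleton ℂ (y i j)).comp_memLp' (hf i j)

/-- Since `m` is controlled only on `s`, it is cut off to zero outside before multiplying; Hölder's
inequality gives boundedness. -/
lemma exists_clm_Lp_eq_apply {α E F : Type*} [MeasurableSpace α] {μ : Measure α}
    [NormedAddCommGroup E] [NormedSpace ℂ E] [NormedAddCommGroup F] [NormedSpace ℂ F]
    (B : E →L[ℂ] F →L[ℂ] F) {s : Set α} (hs : MeasurableSet s)
    {m : α → E} (hm : MemLp m ∞ (μ.restrict s)) :
    ∃ A : Lp F 2 μ →L[ℂ] Lp F 2 μ, ∀ g : Lp F 2 μ, ∀ᵐ x ∂μ, x ∈ s → A g x = B (m x) (g x) := by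
  have hind := (memLp_indicator_iff_restrict hs).2 hm
  refine ⟨B.holderL μ ∞ 2 2 hind.toLp, fun g => ?_⟩
  filter_upwards [B.coeFn_holder (r := 2) hind.toLp g, hind.coeFn_toLp] with x hx hx' hxs
  rw [ContinuousLinearMap.holderL_apply_apply, hx, hx', indicator_of_mem hxs]

lemma exists_multiplication_operator {Ω : Opens (Space d)}
    {a : Space d → Matrix (Fin d) (Fin d) ℂ} (ha : IsBoundedCoeff Ω a) :
    ∃ A : L2Vec d →L[ℝ] L2Vec d, ∀ g : L2Vec d, ∀ᵐ x, x ∈ Ω → A g x = matrixCLM (a x) (g x) := by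
  -- Writing `matrixCLM` as a sum of images of scalar entries reduces measurability and boundedness
  -- to the entries.
  have hmem : MemLp (fun x => matrixCLM (a x)) ∞ (volume.restrict (Ω : Set (Space d))) :=
    memLp_sum_toSpanSingleton (fun i j =>
      (EuclideanSpace.proj j : EuclideanSpace ℂ (Fin d) →L[ℂ] ℂ).smulRight
        (EuclideanSpace.single i 1)) ha
  obtain ⟨A, hA⟩ := exists_clm_Lp_eq_apply (.id ℂ _) Ω.isOpen.measurableSet hmem
  exact ⟨A.restrictScalars ℝ, hA⟩

lemma coercive_of_isUniformlyElliptic {Ω : Opens (Space d)}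
    {a : Space d → Matrix (Fin d) (Fin d) ℂ} (hell : IsUniformlyElliptic Ω a)
    {A : L2Vec d →L[ℝ] L2Vec d} (hA : ∀ g : L2Vec d, ∀ᵐ x, x ∈ Ω → A g x = matrixCLM (a x) (g x)) :
    ∃ η : ℝ, 0 < η ∧ ∀ x ∈ (testSpace Ω).topologicalClosure,
      η * ‖x.snd‖ ^ 2 ≤ ⟪A x.snd, x.snd⟫ := by
  obtain ⟨η, hη, hell⟩ := hell
  refine ⟨η, hη, fun x hx => ?_⟩
  have hclosed : IsClosed {x : WithLp 2 (L2 d × L2Vec d) |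
      η * ‖x.snd‖ ^ 2 ≤ ⟪A x.snd, x.snd⟫} := by
    have hs : Continuous fun x : WithLp 2 (L2 d × L2Vec d) => x.snd :=
      (WithLp.sndL 2 ℝ (L2 d) (L2Vec d)).continuous
    exact isClosed_le (by fun_prop) ((A.continuous.comp hs).inner hs)
  -- By continuity it suffices to treat test functions, where ellipticity is integrated pointwise;
  -- outside `Ω` the gradient vanishes.
  refine closure_minimal ?_ hclosed hx
  rintro y ⟨φ, -, hφ⟩
  rw [mem_ofPred_eq, ← real_inner_self_eq_norm_sq, L2.inner_def, L2.inner_def, ← integral_const_mul]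
  refine integral_mono_ae ((L2.integrable_inner y.snd y.snd).const_mul η)
    (L2.integrable_inner _ _) ?_
  filter_upwards [hφ, hA y.snd, (ae_restrict_iff' Ω.isOpen.measurableSet).1 hell] with p h1 h2 h3
  by_cases hp : p ∈ Ω
  · rw [h2 hp, real_inner_eq_re_inner_euclidean (matrixCLM _ _), inner_matrixCLM,
      real_inner_self_eq_norm_sq]
    exact h3 hp _
  · simp [h1, TestFunction.grad_eq_zero_of_notMem φ hp]

end Coefficients

/-! ### From weak solutions to the abstract equation -/

lemma IsWeakSolution.exists_formSolution {Ω Ω' : Opens (Space d)} (hΩ : Ω' ≤ Ω)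
    {a : Space d → Matrix (Fin d) (Fin d) ℂ}
    {A : L2Vec d →L[ℝ] L2Vec d} (hA : ∀ g : L2Vec d, ∀ᵐ x, x ∈ Ω → A g x = matrixCLM (a x) (g x))
    {u₀ : L2 d} {u : ℝ → L2 d} (hu : IsWeakSolution Ω' a u₀ u) :
    ∃ U : ℝ → WithLp 2 (L2 d × L2Vec d), FormSolution (testSpace Ω').topologicalClosure A U ∧
      ∀ t, (U t).fst = u t := by
  obtain ⟨g, hg, hug, heq⟩ := hu.equation
  have hgi : ∀ s t, 0 < s → s ≤ t → IntervalIntegrable g volume s t := fun s t hs hst => by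
    have h1 := hg (s / 2) (t + 1) (half_pos hs) (by linarith)
    rw [intervalIntegrable_iff_integrableOn_Ioc_of_le hst]
    refine IntegrableOn.mono_set (h1.integrable (by norm_num)) fun r hr => ?_
    exact ⟨by linarith [hr.1], by linarith [hr.2]⟩
  have huc : ContinuousOn u (Ioi 0) := hu.continuousOn.mono Ioi_subset_Ici_self
  refine ⟨fun t => WithLp.toLp 2 (u t, g t), ⟨fun s t hs hst => ?_, ?_, huc, ?_⟩, fun t => rfl⟩
  · have h1 := intervalIntegrable_of_continuousOn_Ioi huc hs hst
    have h2 := hgi s t hs hst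
    rw [intervalIntegrable_iff] at h1 h2 ⊢
    exact (WithLp.prodContinuousLinearEquiv 2 ℝ (L2 d) (L2Vec d)).symm.toContinuousLinearMap
      |>.integrable_comp (h1.prodMk h2)
  · filter_upwards [hug] with t ht
    exact ht.mem_closure_testSpace
  · intro x hx s t hs hst
    have hAi : IntervalIntegrable (fun r => A (g r)) volume s t := by
      have := hgi s t hs hst
      rw [intervalIntegrable_iff] at this ⊢
      exact A.integrable_comp this
    have hint : ∀ y : L2Vec d, ∫ r in s..t, ⟪A (g r), y⟫ = ⟪∫ r in s..t, A (g r), y⟫ := by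
      intro y
      simp only [real_inner_comm y]
      exact (innerSL ℝ y).intervalIntegral_comp_comm hAi
    change ⟪u t, x.fst⟫ - ⟪u s, x.fst⟫ = -∫ r in s..t, ⟪A (g r), x.snd⟫
    -- With the time integral inside the inner product, both sides are visibly continuous in `x`, so
    -- the equation passes from test pairs to their closure.
    rw [hint]
    have hclosed : IsClosed {x : WithLp 2 (L2 d × L2Vec d) |
        ⟪u t, x.fst⟫ - ⟪u s, x.fst⟫ = -⟪∫ r in s..t, A (g r), x.snd⟫} := by
      have h1 : Continuous fun x : WithLp 2 (L2 d × L2Vec d) => x.fst :=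
        (WithLp.fstL 2 ℝ (L2 d) (L2Vec d)).continuous
      have h2 : Continuous fun x : WithLp 2 (L2 d × L2Vec d) => x.snd :=
        (WithLp.sndL 2 ℝ (L2 d) (L2Vec d)).continuous
      exact isClosed_eq (by fun_prop) (by fun_prop)
    refine closure_minimal ?_ hclosed hx
    rintro y ⟨φ, hφ, hφ'⟩
    -- The weak equation is bilinear: testing it with the conjugate of `φ` gives complex inner
    -- products, whose real parts are the real ones.
    have hlhs : ∀ v : L2 d, ⟪v, y.fst⟫ =
        (∫ x in (Ω' : Set (Space d)), v x * TestFunction.conj φ x).re := by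
      intro v
      rw [Lp.real_inner_eq_re_inner real_inner_eq_re_inner_complex, L2.inner_def,
        setIntegral_eq_integral_of_forall_compl_eq_zero
          (fun x hx => by rw [TestFunction.eq_zero_of_notMem _ hx, mul_zero])]
      congr 1
      refine integral_congr_ae ?_
      filter_upwards [hφ] with x hx
      rw [hx, RCLike.inner_apply]
      rfl
    have hrhs : ∀ v : L2Vec d, ∫ x in (Ω' : Set (Space d)),
        matPair (a x) (v x) (grad (TestFunction.conj φ) x) = inner ℂ y.snd (A v) := by
      intro v
      rw [setIntegral_eq_integral_of_forall_compl_eq_zero, L2.inner_def]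
      · refine integral_congr_ae ?_
        filter_upwards [hφ', hA v] with x hx hx'
        rw [hx]
        by_cases hxΩ : x ∈ Ω'
        · rw [hx' (hΩ hxΩ), inner_matrixCLM, matPair]
          refine Finset.sum_congr rfl fun i _ => Finset.sum_congr rfl fun j _ => ?_
          exact congrArg _ (grad_conj_apply (TestFunction.differentiable φ) x i)
        · simp [matPair, TestFunction.grad_eq_zero_of_notMem _ hxΩ]
      · intro x hx
        simp [matPair, TestFunction.grad_eq_zero_of_notMem _ hx]
    have key := congrArg Complex.re (heq (TestFunction.conj φ) s t hs hst)
    simp only [hrhs] at key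
    rw [Complex.sub_re, ← hlhs, ← hlhs, Complex.neg_re] at key
    rw [mem_ofPred_eq, key, Lp.real_inner_eq_re_inner real_inner_eq_re_inner_euclidean]
    congr 2
    exact ((innerSL ℂ y.snd).restrictScalars ℝ).intervalIntegral_comp_comm hAi

end VaryingDomains

end

/-! ### Convergence on varying domains -/

theorem theorem5p1 {d : ℕ} (Ωn : ℕ → Opens (VaryingDomains.Space d))
    (hmono : Monotone Ωn)
    (Ω : Opens (VaryingDomains.Space d))
    (hΩ : (Ω : Set (VaryingDomains.Space d)) = ⋃ n, (Ωn n : Set (VaryingDomains.Space d)))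
    (a : VaryingDomains.Space d → Matrix (Fin d) (Fin d) ℂ)
    (ha : VaryingDomains.IsBoundedCoeff Ω a)
    (hell : VaryingDomains.IsUniformlyElliptic Ω a)
    (u₀n : ℕ → VaryingDomains.L2 d) (hu₀n : ∀ n, u₀n n ∈ VaryingDomains.L2On (Ωn n))
    (u₀ : VaryingDomains.L2 d) (hu₀ : u₀ ∈ VaryingDomains.L2On Ω)
    (un : ℕ → ℝ → VaryingDomains.L2 d)
    (hun : ∀ n, VaryingDomains.IsWeakSolution (Ωn n) a (u₀n n) (un n))
    (u : ℝ → VaryingDomains.L2 d)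
    (hu : VaryingDomains.IsWeakSolution Ω a u₀ u)
    (hlim : Tendsto (fun n => ‖u₀n n - u₀‖) atTop (𝓝 0))
    (T : ℝ) (hT : 0 < T) :
    Tendsto (fun n => ⨆ t ∈ Icc (0 : ℝ) T, ‖un n t - u t‖ₑ) atTop (𝓝 0) := by
  have hle : ∀ n, Ωn n ≤ Ω := fun n x hx => by
    change x ∈ (Ω : Set (VaryingDomains.Space d))
    rw [hΩ]
    exact mem_iUnion_of_mem n hx
  obtain ⟨A, hA⟩ := VaryingDomains.exists_multiplication_operator ha
  obtain ⟨η, hη, hcoer⟩ := VaryingDomains.coercive_of_isUniformlyElliptic hell hA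
  choose Un hUn hUn_fst using fun n => (hun n).exists_formSolution (hle n) hA
  obtain ⟨U, hU, hU_fst⟩ := hu.exists_formSolution le_rfl hA
  have hcomplete : ∀ O : Opens (VaryingDomains.Space d),
      CompleteSpace (VaryingDomains.testSpace O).topologicalClosure := fun O =>
    (Submodule.isClosed_topologicalClosure _).completeSpace_coe
  refine ENNReal.tendsto_nhds_zero.2 fun ε hε => ?_
  -- Here `ε` may be `∞`, while the abstract theorem needs a real bound.
  obtain ⟨ε', hε'0, hε'⟩ : ∃ ε' : ℝ, 0 < ε' ∧ ENNReal.ofReal ε' ≤ ε := by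
    rcases eq_or_ne ε ∞ with rfl | h
    · exact ⟨1, one_pos, le_top⟩
    · exact ⟨ε.toReal, ENNReal.toReal_pos hε.ne' h, (ENNReal.ofReal_toReal h).le⟩
  have hfst : (fun t => (U t).fst) = u := funext hU_fst
  have hfstn : ∀ n, (fun t => (Un n t).fst) = un n := fun n => funext (hUn_fst n)
  have h := VaryingDomains.eventually_norm_fst_sub_le
    (V := fun n => (VaryingDomains.testSpace (Ωn n)).topologicalClosure)
    (fun m n hmn => Submodule.topologicalClosure_mono (VaryingDomains.testSpace_mono (hmono hmn)))
    (fun n => Submodule.topologicalClosure_mono (VaryingDomains.testSpace_mono (hle n)))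
    (Submodule.topologicalClosure_mono ((VaryingDomains.testSpace_le_iSup hmono hΩ).trans
      (iSup_mono fun n => Submodule.le_topologicalClosure _)))
    hη hcoer hUn (fun n => hfstn n ▸ (hun n).continuousOn) hU (hfst ▸ hu.continuousOn)
    (by simpa only [hUn_fst, hU_fst, (hun _).initial, hu.initial] using hlim) hT hε'0
  filter_upwards [h] with n hn
  refine iSup₂_le fun t ht => le_trans ?_ hε'
  rw [← ofReal_norm, ← hUn_fst n, ← hU_fst]
  exact ENNReal.ofReal_le_ofReal (hn t ht)
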